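/- **Notation.** For a real matrix $M\in\mathbb{R}^{n\times m}$, let $\mathcal{Q}(M)\subseteq\mathbb{R}^{n\times m}$ be the set of all real matrices $X$ with the same sign pattern as $M$ (that is, for all $i,j$: $X_{ij}>0$ if $M_{ij}>0$, $X_{ij}<0$ if $M_{ij}<0$, and $X_{ij}=0$ if $M_{ij}=0$), and let $\mathcal{Q}_0(M)$ be its closure in $\mathbb{R}^{n\times m}$. For $A\in\mathbb{R}^{n\times m}$ and $B\in\mathbb{R}^{m\times n}$, the DSR graph $G_{A,B}$ is the signed, labelled bipartite digraph with vertices $S_1,\dots,S_n$ and $R_1,\dots,R_m$, with an arc $R_jS_i$ of sign $\mathrm{sign}(A_{ij})$ whenever $A_{ij}\neq 0$ and an arc $S_iR_j$ of sign $\mathrm{sign}(B_{ji})$ whenever $B_{ji}\neq 0$; a pair of antiparallel arcs of the same sign is treated as a single undirected edge, which can be traversed both ways. An edge associated with a nonzero entry $A_{ij}$ has label $|A_{ij}|$, and an edge that comes only from $B$ has label $\infty$. A cycle is a nonempty closed directed walk that repeats no vertex (other than its first and last vertex being equal) and no edge; in particular, going back and forth along a single undirected edge is not a cycle. The graph is acyclic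 if it has no cycles. A real square matrix is a $P_0$-matrix if all its principal minors are nonnegative, and it is positive semistable if all its complex eigenvalues have nonnegative real part. For $M\in\mathbb{R}^{n\times n}$, the second additive compound $M^{[2]}$ is the matrix, in the basis $(e_i\wedge e_j)_{i<j}$ of $\Lambda^2\mathbb{R}^n$, of the linear map $u\wedge v\mapsto Mu\wedge v+u\wedge Mv$. (For $n<2$ it is the empty matrix, which is a $P_0$-matrix.) **Theorem.** Let $C\in\mathbb{R}^{n\times m}$ be such that the DSR graph $G_{C,C^t}$ is acyclic. Then, for every $A\in\mathcal{Q}_0(C)$ and every $B\in\mathcal{Q}_0(C^t)$, both $AB$ and $(AB)^{[2]}$ are $P_0$-matrices, and $AB$ is positive semistable. -/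

import Mathlib

noncomputable section

namespace DSR

/-! ### Qualitative classes -/

/-- The qualitative class of `M`: all matrices with the same sign pattern as `M`. -/
def qualClass {n m : ℕ} (M : Matrix (Fin n) (Fin m) ℝ) : Set (Matrix (Fin n) (Fin m) ℝ) :=
  {X | ∀ i j, (0 < M i j → 0 < X i j) ∧ (M i j < 0 → X i j < 0) ∧ (M i j = 0 → X i j = 0)}

/-- The closure of the qualitative class of `M` in the space of real `n × m` matrices. -/
def qualClass₀ {n m : ℕ} (M : Matrix (Fin n) (Fin m) ℝ) : Set (Matrix (Fin n) (Fin m) ℝ) :=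
  closure (qualClass M)

/-! ### `P₀`-matrices and positive semistability -/

/-- A `P₀`-matrix: a real square matrix all of whose principal minors are nonnegative. -/
def IsP₀ {ι : Type*} [DecidableEq ι] (M : Matrix ι ι ℝ) : Prop :=
  ∀ α : Finset ι, α.Nonempty → 0 ≤ (M.submatrix (fun i : α => (i : ι)) (fun i : α => (i : ι))).det

/-- All complex eigenvalues of the real square matrix `M` lie in the closed right half-plane. -/
def PositiveSemistable {n : ℕ} (M : Matrix (Fin n) (Fin n) ℝ) : Prop :=
  ∀ z ∈ spectrum ℂ (M.map (algebraMap ℝ ℂ)), 0 ≤ z.re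

/-! ### Second additive compound -/

/-- The alternating map `(u₀, u₁) ↦ f u₀ ∧ u₁ + u₀ ∧ f u₁`. -/
def additiveCompoundAux {V : Type*} [AddCommGroup V] [Module ℝ V] (f : V →ₗ[ℝ] V) :
    V [⋀^Fin 2]→ₗ[ℝ] (⋀[ℝ]^2 V) where
  toFun u := exteriorPower.ιMulti ℝ 2 ![f (u 0), u 1] + exteriorPower.ιMulti ℝ 2 ![u 0, f (u 1)]
  map_update_add' := by
    intro _ u i x y
    have h0 : ∀ a b c : V, exteriorPower.ιMulti ℝ 2 ![a + b, c] =
        exteriorPower.ιMulti ℝ 2 ![a, c] + exteriorPower.ιMulti ℝ 2 ![b, c] := fun a b c => by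
      have h := (exteriorPower.ιMulti ℝ 2).map_update_add ![a, c] 0 a b
      have e : ∀ x : V, Function.update ![a, c] 0 x = ![x, c] := fun x => by
        funext k
        fin_cases k <;> simp
      rwa [e, e, e] at h
    have h1 : ∀ a b c : V, exteriorPower.ιMulti ℝ 2 ![c, a + b] =
        exteriorPower.ιMulti ℝ 2 ![c, a] + exteriorPower.ιMulti ℝ 2 ![c, b] := fun a b c => by
      have h := (exteriorPower.ιMulti ℝ 2).map_update_add ![c, a] 1 a b
      have e : ∀ x : V, Function.update ![c, a] 1 x = ![c, x] := fun x => by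
        funext k
        fin_cases k <;> simp
      rwa [e, e, e] at h
    fin_cases i <;> simp [h0, h1] <;> abel
  map_update_smul' := by
    intro _ u i c x
    have h0 : ∀ a b : V, exteriorPower.ιMulti ℝ 2 ![c • a, b] =
        c • exteriorPower.ιMulti ℝ 2 ![a, b] := fun a b => by
      have h := (exteriorPower.ιMulti ℝ 2).map_update_smul ![a, b] 0 c a
      have e : ∀ x : V, Function.update ![a, b] 0 x = ![x, b] := fun x => by
        funext k
        fin_cases k <;> simp
      rwa [e, e] at h
    have h1 : ∀ a b : V, exteriorPower.ιMulti ℝ 2 ![a, c • b] =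
        c • exteriorPower.ιMulti ℝ 2 ![a, b] := fun a b => by
      have h := (exteriorPower.ιMulti ℝ 2).map_update_smul ![a, b] 1 c b
      have e : ∀ x : V, Function.update ![a, b] 1 x = ![a, x] := fun x => by
        funext k
        fin_cases k <;> simp
      rwa [e, e] at h
    fin_cases i <;> simp [h0, h1]
  map_eq_zero_of_eq' := by
    intro u i j hu hij
    have h01 : u 0 = u 1 := by
      fin_cases i <;> fin_cases j <;> simp_all
    have h := (exteriorPower.ιMulti ℝ 2).map_swap ![f (u 1), u 1] (i := 0) (j := 1) (by decide)
    have e : (![f (u 1), u 1] ∘ Equiv.swap (0 : Fin 2) 1) = ![u 1, f (u 1)] := by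
      ext k
      fin_cases k <;> simp
    rw [e] at h
    rw [h01, h]
    simp

/-- The second additive compound of an endomorphism `f`, as an endomorphism of the second exterior
power: the linear map with `u ∧ v ↦ f u ∧ v + u ∧ f v`. -/
def additiveCompound {V : Type*} [AddCommGroup V] [Module ℝ V] (f : V →ₗ[ℝ] V) :
    ⋀[ℝ]^2 V →ₗ[ℝ] ⋀[ℝ]^2 V :=
  exteriorPower.alternatingMapLinearEquiv (additiveCompoundAux f)

/-- The second additive compound matrix `M^{[2]}`: the matrix of the second additive compound of `M`
in the basis `eᵢ ∧ eⱼ`, `i < j`, indexed by the two-element subsets `{i, j}`. -/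
def secondAdditiveCompound {n : ℕ} (M : Matrix (Fin n) (Fin n) ℝ) :
    Matrix (Set.powersetCard (Fin n) 2) (Set.powersetCard (Fin n) 2) ℝ :=
  LinearMap.toMatrix ((Pi.basisFun ℝ (Fin n)).exteriorPower 2)
    ((Pi.basisFun ℝ (Fin n)).exteriorPower 2) (additiveCompound (Matrix.toLin' M))

/-! ### DSR graphs -/

/-- A potential edge of a DSR graph, joining the S-vertex `S_s` and the R-vertex `R_r`, with a sign.
Two antiparallel arcs of the same sign are the same edge, traversable both ways. -/
@[ext]
structure Edge (n m : ℕ) where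
  s : Fin n
  r : Fin m
  sgn : SignType

/-- A labelled signed bipartite graph on `S_1, …, S_n` and `R_1, …, R_m` whose edges may have
R-to-S orientation, S-to-R orientation, or both (undirected edges). -/
structure Graph (n m : ℕ) where
  /-- the edges that can be traversed from their R-vertex to their S-vertex -/
  rToS : Set (Edge n m)
  /-- the edges that can be traversed from their S-vertex to their R-vertex -/
  sToR : Set (Edge n m)
  /-- the edge labels, only meaningful on edges -/
  label : Edge n m → WithTop ℝ

open Classical in
/-- The DSR graph `G_{A,B}`. -/
def dsrGraph {n m : ℕ} (A : Matrix (Fin n) (Fin m) ℝ) (B : Matrix (Fin m) (Fin n) ℝ) :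
    Graph n m where
  rToS := {e | A e.s e.r ≠ 0 ∧ e.sgn = SignType.sign (A e.s e.r)}
  sToR := {e | B e.r e.s ≠ 0 ∧ e.sgn = SignType.sign (B e.r e.s)}
  label e := if A e.s e.r ≠ 0 ∧ e.sgn = SignType.sign (A e.s e.r) then
    ((|A e.s e.r| : ℝ) : WithTop ℝ) else ⊤

namespace Graph

variable {n m : ℕ}

/-- `G.Arc u e v`: the edge `e` of `G` can be traversed from the vertex `u` to the vertex `v`.
The S-vertices are `Sum.inl i` and the R-vertices are `Sum.inr j`. -/
def Arc (G : Graph n m) : Fin n ⊕ Fin m → Edge n m → Fin n ⊕ Fin m → Prop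
  | Sum.inr j, e, Sum.inl i => e ∈ G.rToS ∧ e.r = j ∧ e.s = i
  | Sum.inl i, e, Sum.inr j => e ∈ G.sToR ∧ e.s = i ∧ e.r = j
  | _, _, _ => False

/-- Walks in `G`, possibly empty, with repetitions of vertices and edges allowed. -/
inductive Walk (G : Graph n m) : Fin n ⊕ Fin m → Fin n ⊕ Fin m → Type
  | nil (u : Fin n ⊕ Fin m) : Walk G u u
  | cons {u v w : Fin n ⊕ Fin m} (e : Edge n m) (h : G.Arc u e v) (p : Walk G v w) : Walk G u w

/-- The vertices of a walk, in order, without the first one. -/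
def Walk.tailVertices {G : Graph n m} : {u v : Fin n ⊕ Fin m} → G.Walk u v → List (Fin n ⊕ Fin m)
  | _, _, .nil _ => []
  | _, _, .cons (v := v) _ _ p => v :: p.tailVertices

/-- The edges of a walk, in order. -/
def Walk.edges {G : Graph n m} : {u v : Fin n ⊕ Fin m} → G.Walk u v → List (Edge n m)
  | _, _, .nil _ => []
  | _, _, .cons e _ p => e :: p.edges

/-- A cycle is a nonempty closed walk that repeats no vertex, except that the first and last
vertices are the same, and no edge. The last condition only excludes going back and forth along a
single undirected edge; two antiparallel arcs of opposite signs form a cycle of length two. -/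
structure Walk.IsCycle {G : Graph n m} {u : Fin n ⊕ Fin m} (p : G.Walk u u) : Prop where
  edges_ne_nil : p.edges ≠ []
  nodup_vertices : p.tailVertices.Nodup
  nodup_edges : p.edges.Nodup

/-- A graph is acyclic if it has no cycles. -/
def Acyclic (G : Graph n m) : Prop :=
  ∀ (u : Fin n ⊕ Fin m) (p : G.Walk u u), ¬ p.IsCycle

end Graph

end DSR

end

open Matrix

/-! In `G_{C,Cᵗ}` every edge is undirected, so acyclicity says that the bipartite graph of nonzero
entries of `C` is a forest. For `A`, `B` in the open classes the ratios `B j i / A i j` over its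
edges are positive, and on a forest they factor as `d j * c i` (`exists_scaling`). Hence `AB = A D
Aᵗ Γ` with `D = diag d` and `Γ = diag c`, which is diagonally similar to the Gram matrix `L Lᵗ`, `L
= Γ^{1/2} A D^{1/2}`. Diagonal similarity preserves principal minors and spectrum and is compatible
with second compounds, and the second compound of a positive semidefinite matrix is positive
semidefinite. The closures follow by continuity, with semistability replaced by a closed condition:
a lower bound on `|det (z - AB)|` for `Re z < 0`. -/

namespace SimpleGraph

/-- On an acyclic graph every antisymmetric function on arcs is the gradient of a potential. -/
theorem IsAcyclic.exists_potential {V : Type*} {G : SimpleGraph V} (hG : G.IsAcyclic)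
    (f : V → V → ℝ) (hf : ∀ u v, f u v = -f v u) :
    ∃ p : V → ℝ, ∀ u v, G.Adj u v → p v - p u = f u v := by
  classical
  have hroot : ∀ v, ∃ q : G.Walk (G.connectedComponentMk v).out v, q.IsPath := fun v =>
    (ConnectedComponent.exact (G.connectedComponentMk v).out_eq).exists_isPath
  choose q hq using hroot
  let W : ∀ {u v : V}, G.Walk u v → ℝ := fun p => (p.darts.map fun d => f d.fst d.snd).sum
  have hconcat : ∀ {r u v : V} (p : G.Walk r u) (p' : G.Walk r v), p.IsPath → p'.IsPath →
      G.Adj u v → u ∈ p'.support → W p' - W p = f u v := by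
    intro r u v p p' hp hp' h hu
    rw [hG.path_concat hp hp' h hu]
    simp [W, Walk.darts_concat]
  have hadj : ∀ {r u v : V} (p : G.Walk r u) (p' : G.Walk r v), p.IsPath → p'.IsPath →
      G.Adj u v → W p' - W p = f u v := by
    intro r u v p p' hp hp' h
    -- In a forest, of the root paths to two adjacent vertices, one extends the other by the joining
    -- edge.
    by_cases hu : u ∈ p'.support
    · exact hconcat p p' hp hp' h hu
    · have hv := hG.mem_support_of_ne_mem_support_of_adj_of_isPath hp hp' h hu
      have := hconcat p' p hp' hp h.symm hv
      rw [hf u v]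
      linarith
  refine ⟨fun v => W (q v), fun u v h => ?_⟩
  have hr : (G.connectedComponentMk u).out = (G.connectedComponentMk v).out := by
    rw [ConnectedComponent.connectedComponentMk_eq_of_adj h]
  have := hadj (q u) ((q v).copy hr.symm rfl) (hq u) (by simpa using hq v) h
  simpa [W] using this

end SimpleGraph

namespace DSR

variable {n m : ℕ}

/-! ### Forest patterns and diagonal scalings -/

/-- The undirected bipartite graph of the nonzero entries of a matrix. -/
def bipartiteGraph (C : Matrix (Fin n) (Fin m) ℝ) : SimpleGraph (Fin n ⊕ Fin m) where
  Adj
    | Sum.inl i, Sum.inr j => C i j ≠ 0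
    | Sum.inr j, Sum.inl i => C i j ≠ 0
    | _, _ => False
  symm := ⟨by rintro (i | i) (j | j) h <;> exact h⟩
  loopless := ⟨by rintro (i | i) h <;> exact h⟩

/-- The unordered pair of end vertices of an edge. -/
def Edge.ends (e : Edge n m) : Sym2 (Fin n ⊕ Fin m) := s(Sum.inl e.s, Sum.inr e.r)

theorem exists_arc_of_adj {C : Matrix (Fin n) (Fin m) ℝ} {u v : Fin n ⊕ Fin m}
    (h : (bipartiteGraph C).Adj u v) :
    ∃ e : Edge n m, (dsrGraph C C.transpose).Arc u e v ∧ e.ends = s(u, v) := by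
  rcases u with i | j <;> rcases v with i' | j'
  · exact h.elim
  · exact ⟨⟨i, j', SignType.sign (C i j')⟩, ⟨⟨h, rfl⟩, rfl, rfl⟩, rfl⟩
  · exact ⟨⟨i', j, SignType.sign (C i' j)⟩, ⟨⟨h, rfl⟩, rfl, rfl⟩, Sym2.eq_swap⟩
  · exact h.elim

/-- The two recorded lists are what is needed to carry a simple cycle over to a DSR cycle. -/
theorem exists_walk_of_walk {C : Matrix (Fin n) (Fin m) ℝ} {u v : Fin n ⊕ Fin m}
    (p : (bipartiteGraph C).Walk u v) :
    ∃ q : (dsrGraph C C.transpose).Walk u v,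
      q.tailVertices = p.support.tail ∧ q.edges.map Edge.ends = p.edges := by
  induction p with
  | nil => exact ⟨.nil _, rfl, rfl⟩
  | cons h p ih =>
    obtain ⟨q, hv, he⟩ := ih
    obtain ⟨e, ha, hs⟩ := exists_arc_of_adj h
    refine ⟨.cons e ha q, ?_, ?_⟩
    · rw [Graph.Walk.tailVertices, hv, SimpleGraph.Walk.support_cons, List.tail_cons,
        SimpleGraph.Walk.cons_tail_support]
    · simp [Graph.Walk.edges, hs, he]

theorem isAcyclic_bipartiteGraph {C : Matrix (Fin n) (Fin m) ℝ}
    (hC : (dsrGraph C C.transpose).Acyclic) : (bipartiteGraph C).IsAcyclic := by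
  intro u p hp
  obtain ⟨q, hv, he⟩ := exists_walk_of_walk p
  refine hC u q ⟨fun h => ?_, hv ▸ hp.support_nodup, .of_map _ (he ▸ hp.edges_nodup)⟩
  rw [h, List.map_nil, eq_comm, SimpleGraph.Walk.edges_eq_nil] at he
  exact hp.ne_nil he.eq_nil

/-- If the pattern of `C` is a forest, then any `B` in the class of `Cᵗ` is obtained from the
transpose of any `A` in the class of `C` by positive scalings of rows and columns. -/
theorem exists_scaling {C : Matrix (Fin n) (Fin m) ℝ} (hC : (dsrGraph C C.transpose).Acyclic)
    {A : Matrix (Fin n) (Fin m) ℝ} (hA : A ∈ qualClass C)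
    {B : Matrix (Fin m) (Fin n) ℝ} (hB : B ∈ qualClass C.transpose) :
    ∃ (c : Fin n → ℝ) (d : Fin m → ℝ), (∀ i, 0 < c i) ∧ (∀ j, 0 < d j) ∧
      ∀ i j, B j i = d j * A i j * c i := by
  -- Logarithms turn the factorization `B j i / A i j = d j * c i` into a potential problem.
  let f : Fin n ⊕ Fin m → Fin n ⊕ Fin m → ℝ
    | Sum.inl i, Sum.inr j => Real.log (B j i / A i j)
    | Sum.inr j, Sum.inl i => -Real.log (B j i / A i j)
    | _, _ => 0
  obtain ⟨p, hp⟩ := (isAcyclic_bipartiteGraph hC).exists_potential f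
    (by rintro (i | i) (j | j) <;> simp [f])
  refine ⟨fun i => Real.exp (-p (Sum.inl i)), fun j => Real.exp (p (Sum.inr j)),
    fun i => Real.exp_pos _, fun j => Real.exp_pos _, fun i j => ?_⟩
  obtain ⟨hA₁, hA₂, hA₃⟩ := hA i j
  obtain ⟨hB₁, hB₂, hB₃⟩ := hB j i
  rw [transpose_apply] at hB₁ hB₂ hB₃
  by_cases h0 : C i j = 0
  · simp [hA₃ h0, hB₃ h0]
  · have hpos : 0 < B j i / A i j := by
      rcases lt_or_gt_of_ne h0 with h | h
      · exact div_pos_of_neg_of_neg (hB₂ h) (hA₂ h)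
      · exact div_pos (hB₁ h) (hA₁ h)
    have hA0 : A i j ≠ 0 := fun h => by simp [h] at hpos
    have h : p (Sum.inr j) - p (Sum.inl i) = Real.log (B j i / A i j) :=
      hp (Sum.inl i) (Sum.inr j) h0
    rw [mul_right_comm, ← Real.exp_add, ← sub_eq_add_neg, h, Real.exp_log hpos,
      div_mul_cancel₀ _ hA0]

theorem exists_posSemidef_conj {C : Matrix (Fin n) (Fin m) ℝ}
    (hC : (dsrGraph C C.transpose).Acyclic)
    {A : Matrix (Fin n) (Fin m) ℝ} (hA : A ∈ qualClass C)
    {B : Matrix (Fin m) (Fin n) ℝ} (hB : B ∈ qualClass C.transpose) :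
    ∃ (d : Fin n → ℝ) (S : Matrix (Fin n) (Fin n) ℝ), (∀ i, d i ≠ 0) ∧ S.PosSemidef ∧
      ∀ i j, (A * B) i j = (d i)⁻¹ * S i j * d j := by
  obtain ⟨c, d, hc, hd, h⟩ := exists_scaling hC hA hB
  have hc0 : ∀ i, √(c i) ≠ 0 := fun i => (Real.sqrt_pos.2 (hc i)).ne'
  let L : Matrix (Fin n) (Fin m) ℝ := of fun i k => √(c i) * A i k * √(d k)
  refine ⟨fun i => √(c i), L * Lᴴ, hc0, posSemidef_self_mul_conjTranspose L, fun i j => ?_⟩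
  simp only [mul_apply, conjTranspose_apply, star_trivial, L, of_apply, Finset.mul_sum,
    Finset.sum_mul]
  refine Finset.sum_congr rfl fun k _ => ?_
  have h1 := Real.mul_self_sqrt (hc j).le
  have h2 := Real.mul_self_sqrt (hd k).le
  have h3 := inv_mul_cancel₀ (hc0 i)
  rw [h j k]
  calc A i k * (d k * A j k * c j)
      = A i k * ((√(d k) * √(d k)) * A j k * (√(c j) * √(c j))) := by rw [h1, h2]
    _ = ((√(c i))⁻¹ * √(c i)) * (A i k * ((√(d k) * √(d k)) * A j k * (√(c j) * √(c j)))) := by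
        rw [h3, one_mul]
    _ = _ := by ring

/-- In each principal minor the diagonal factors cancel, leaving a principal minor of `S`. -/
theorem isP₀_of_posSemidef_conj {ι : Type*} [DecidableEq ι] {M S : Matrix ι ι ℝ} {d : ι → ℝ}
    (hd : ∀ i, d i ≠ 0) (hS : S.PosSemidef) (h : ∀ i j, M i j = (d i)⁻¹ * S i j * d j) :
    IsP₀ M := by
  intro α _
  have hM : M.submatrix (fun i : α => (i : ι)) (fun i : α => (i : ι)) =
      diagonal (fun i : α => (d i)⁻¹) * S.submatrix (fun i : α => (i : ι)) (fun i : α => (i : ι)) *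
        diagonal (fun i : α => d i) := by
    ext i j
    simp [h]
  have hprod : (∏ i : α, (d i)⁻¹) * ∏ i : α, d i = 1 := by
    rw [← Finset.prod_mul_distrib]
    exact Finset.prod_eq_one fun i _ => inv_mul_cancel₀ (hd i)
  rw [hM, det_mul, det_mul, det_diagonal, det_diagonal, mul_right_comm, hprod, one_mul]
  exact (hS.submatrix _).det_nonneg

theorem isClosed_isP₀ {ι : Type*} [DecidableEq ι] : IsClosed {M : Matrix ι ι ℝ | IsP₀ M} := by
  simp only [IsP₀, Set.ofPred_forall]
  refine isClosed_iInter fun α => isClosed_iInter fun _ => isClosed_le continuous_const ?_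
  exact (continuous_id.matrix_submatrix _ _).matrix_det

/-! ### Second additive compound -/

/-- The incidence of ordered pairs with two-element subsets, signed by the order of the pair. -/
def wedgeMatrix (n : ℕ) : Matrix (Fin n × Fin n) (Set.powersetCard (Fin n) 2) ℝ :=
  of fun a s => (if a.1 = Set.powersetCard.ofFinEmbEquiv.symm s 0 then 1 else 0) *
      (if a.2 = Set.powersetCard.ofFinEmbEquiv.symm s 1 then 1 else 0) -
    (if a.1 = Set.powersetCard.ofFinEmbEquiv.symm s 1 then 1 else 0) *
      (if a.2 = Set.powersetCard.ofFinEmbEquiv.symm s 0 then 1 else 0)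

theorem secondAdditiveCompound_apply (M : Matrix (Fin n) (Fin n) ℝ)
    (s t : Set.powersetCard (Fin n) 2) {i j k l : Fin n}
    (hi : i = Set.powersetCard.ofFinEmbEquiv.symm s 0)
    (hj : j = Set.powersetCard.ofFinEmbEquiv.symm s 1)
    (hk : k = Set.powersetCard.ofFinEmbEquiv.symm t 0)
    (hl : l = Set.powersetCard.ofFinEmbEquiv.symm t 1) :
    secondAdditiveCompound M s t =
      M i k * (1 : Matrix _ _ ℝ) j l - M j k * (1 : Matrix _ _ ℝ) i l +
        ((1 : Matrix _ _ ℝ) i k * M j l - (1 : Matrix _ _ ℝ) j k * M i l) := by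
  have ht : (Pi.basisFun ℝ (Fin n)).exteriorPower 2 t =
      exteriorPower.ιMulti ℝ 2 ![Pi.single k 1, Pi.single l 1] := by
    rw [exteriorPower.basis_apply, exteriorPower.ιMulti_family]
    congr 1
    ext a : 1
    fin_cases a <;> simp [hk, hl]
  rw [secondAdditiveCompound, LinearMap.toMatrix_apply, ht, additiveCompound,
    exteriorPower.alternatingMapLinearEquiv_apply_ιMulti, exteriorPower.basis_repr_apply]
  simp [additiveCompoundAux, det_fin_two, ← hi, ← hj, Pi.single_apply, one_apply]

/-- This congruence form makes positive semidefiniteness pass from `M` to its compound. On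
antisymmetric tensors `M ⊗ 1` and `1 ⊗ M` contribute equally, and the columns of `wedgeMatrix` have
squared norm 2, so `M ⊗ 1` alone suffices. -/
theorem secondAdditiveCompound_eq (M : Matrix (Fin n) (Fin n) ℝ) :
    secondAdditiveCompound M =
      (wedgeMatrix n)ᵀ * kroneckerMap (· * ·) M (1 : Matrix (Fin n) (Fin n) ℝ) * wedgeMatrix n := by
  ext s t
  rw [secondAdditiveCompound_apply M s t rfl rfl rfl rfl]
  simp only [mul_apply, wedgeMatrix, transpose_apply, of_apply, kroneckerMap_apply,
    Fintype.sum_prod_type, sub_mul, mul_sub, Finset.sum_sub_distrib]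
  simp [one_apply, @eq_comm _ (Set.powersetCard.ofFinEmbEquiv.symm t _)]
  ring

theorem isP₀_secondAdditiveCompound_of_posSemidef_conj {M S : Matrix (Fin n) (Fin n) ℝ}
    {d : Fin n → ℝ} (hd : ∀ i, d i ≠ 0) (hS : S.PosSemidef)
    (h : ∀ i j, M i j = (d i)⁻¹ * S i j * d j) : IsP₀ (secondAdditiveCompound M) := by
  refine isP₀_of_posSemidef_conj (S := secondAdditiveCompound S)
    (d := fun s => d (Set.powersetCard.ofFinEmbEquiv.symm s 0) *
      d (Set.powersetCard.ofFinEmbEquiv.symm s 1))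
    (fun s => mul_ne_zero (hd _) (hd _)) ?_ fun s t => ?_
  · rw [secondAdditiveCompound_eq]
    simpa using (hS.kronecker PosSemidef.one).conjTranspose_mul_mul_same (wedgeMatrix n)
  · rw [secondAdditiveCompound_apply M s t rfl rfl rfl rfl,
      secondAdditiveCompound_apply S s t rfl rfl rfl rfl]
    simp only [h]
    -- The identity is fixed by the conjugation, so each term `M * 1` of the compound scales by the
    -- same pair products.
    have h1 : ∀ i j, (1 : Matrix (Fin n) (Fin n) ℝ) i j =
        (d i)⁻¹ * (1 : Matrix (Fin n) (Fin n) ℝ) i j * d j := by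
      intro i j
      by_cases hij : i = j
      · rw [hij, one_apply_eq, mul_one, inv_mul_cancel₀ (hd j)]
      · simp [hij]
    generalize (Set.powersetCard.ofFinEmbEquiv.symm s) 0 = i
    generalize (Set.powersetCard.ofFinEmbEquiv.symm s) 1 = j
    generalize (Set.powersetCard.ofFinEmbEquiv.symm t) 0 = k
    generalize (Set.powersetCard.ofFinEmbEquiv.symm t) 1 = l
    rw [mul_inv]
    linear_combination (d i)⁻¹ * S i k * d k * h1 j l - (d j)⁻¹ * S j k * d k * h1 i l +
      (d j)⁻¹ * S j l * d l * h1 i k - (d i)⁻¹ * S i l * d l * h1 j k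

theorem continuous_secondAdditiveCompound :
    Continuous (secondAdditiveCompound : Matrix (Fin n) (Fin n) ℝ → _) := by
  refine continuous_matrix fun s t => ?_
  simp only [fun M : Matrix (Fin n) (Fin n) ℝ =>
    secondAdditiveCompound_apply M s t rfl rfl rfl rfl]
  fun_prop

/-! ### Spectrum and passage to the closure -/

/-- A quantitative form of positive semistability with real spectrum, which passes to limits. -/
theorem le_norm_eval_charpoly_of_posSemidef_conj {M S : Matrix (Fin n) (Fin n) ℝ}
    {d : Fin n → ℝ} (hd : ∀ i, d i ≠ 0) (hS : S.PosSemidef)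
    (h : ∀ i j, M i j = (d i)⁻¹ * S i j * d j) {z : ℂ} (hz : z.re < 0) :
    (-z.re) ^ n ≤ ‖(scalar (Fin n) z - M.map (algebraMap ℝ ℂ)).det‖ := by
  have hM : M = diagonal (fun i => (d i)⁻¹) * (S * diagonal d) := by
    ext i j
    simp [h, mul_assoc]
  have hc : M.charpoly = S.charpoly := by
    have hdd : diagonal d * diagonal (fun i => (d i)⁻¹) = 1 := by
      simp [diagonal_mul_diagonal, hd]
    rw [hM, charpoly_mul_comm, Matrix.mul_assoc, hdd, Matrix.mul_one]
  rw [← eval_charpoly, charpoly_map, hc, hS.isHermitian.charpoly_eq]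
  simp only [Polynomial.map_prod, Polynomial.eval_prod, norm_prod]
  have hpow : (-z.re) ^ n = ∏ _i : Fin n, (-z.re) := by simp
  rw [hpow]
  -- Factorwise, `|z - λ| ≥ |Re z - λ| ≥ -Re z`, since each eigenvalue `λ` of `S` is real and
  -- nonnegative.
  refine Finset.prod_le_prod (fun _ _ => by linarith) fun i _ => ?_
  have hi := hS.eigenvalues_nonneg i
  refine le_trans ?_ (Complex.abs_re_le_norm _)
  simp
  rw [abs_of_neg (by linarith)]
  linarith

theorem positiveSemistable_of_le {M : Matrix (Fin n) (Fin n) ℝ}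
    (h : ∀ z : ℂ, z.re < 0 →
      (-z.re) ^ n ≤ ‖(scalar (Fin n) z - M.map (algebraMap ℝ ℂ)).det‖) :
    PositiveSemistable M := by
  intro z hz
  by_contra! hneg
  rw [mem_spectrum_iff_isRoot_charpoly, Polynomial.IsRoot, eval_charpoly] at hz
  have := h z hneg
  rw [hz, norm_zero] at this
  exact absurd (pow_pos (neg_pos.2 hneg) n) this.not_gt

theorem isClosed_le_norm_det :
    IsClosed {M : Matrix (Fin n) (Fin n) ℝ | ∀ z : ℂ, z.re < 0 →
      (-z.re) ^ n ≤ ‖(scalar (Fin n) z - M.map (algebraMap ℝ ℂ)).det‖} := by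
  simp only [Set.ofPred_forall]
  refine isClosed_iInter fun z => isClosed_iInter fun _ => isClosed_le continuous_const ?_
  have : Continuous fun M : Matrix (Fin n) (Fin n) ℝ => M.map (algebraMap ℝ ℂ) :=
    continuous_id.matrix_map Complex.continuous_ofReal
  exact ((continuous_const.sub this).matrix_det).norm

end DSR

theorem mainTheorem2 (n m : ℕ) (C : Matrix (Fin n) (Fin m) ℝ)
    (hC : (DSR.dsrGraph C C.transpose).Acyclic)
    (A : Matrix (Fin n) (Fin m) ℝ) (hA : A ∈ DSR.qualClass₀ C)
    (B : Matrix (Fin m) (Fin n) ℝ) (hB : B ∈ DSR.qualClass₀ C.transpose) :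
    DSR.IsP₀ (A * B) ∧ DSR.IsP₀ (DSR.secondAdditiveCompound (A * B)) ∧
      DSR.PositiveSemistable (A * B) := by
  have hAB : (A, B) ∈ closure (DSR.qualClass C ×ˢ DSR.qualClass C.transpose) := by
    rw [closure_prod_eq]
    exact ⟨hA, hB⟩
  have hmul : Continuous fun X : Matrix (Fin n) (Fin m) ℝ × Matrix (Fin m) (Fin n) ℝ =>
      X.1 * X.2 := continuous_fst.matrix_mul continuous_snd
  have key := closure_minimal (t := {X | DSR.IsP₀ (X.1 * X.2)} ∩
      ({X | DSR.IsP₀ (DSR.secondAdditiveCompound (X.1 * X.2))} ∩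
        {X | ∀ z : ℂ, z.re < 0 → (-z.re) ^ n ≤
          ‖(scalar (Fin n) z - (X.1 * X.2).map (algebraMap ℝ ℂ)).det‖})) ?_ ?_ hAB
  · exact ⟨key.1, key.2.1, DSR.positiveSemistable_of_le key.2.2⟩
  · rintro ⟨X, Y⟩ ⟨hX, hY⟩
    obtain ⟨d, S, hd, hS, h⟩ := DSR.exists_posSemidef_conj hC hX hY
    exact ⟨DSR.isP₀_of_posSemidef_conj hd hS h,
      DSR.isP₀_secondAdditiveCompound_of_posSemidef_conj hd hS h,
      fun z hz => DSR.le_norm_eval_charpoly_of_posSemidef_conj hd hS h hz⟩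
  · exact (DSR.isClosed_isP₀.preimage hmul).inter
      ((DSR.isClosed_isP₀.preimage (DSR.continuous_secondAdditiveCompound.comp hmul)).inter
        (DSR.isClosed_le_norm_det.preimage hmul))
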